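/- Let $\mathbb{D}=\{z\in\mathbb{C}:|z|<1\}$. For functions $h,g$ on $\mathbb{D}$ write $h\prec g$ if there is an analytic function $w$ on $\mathbb{D}$ with $w(0)=0$ and $|w(z)|\le|z|$ such that $h(z)=g(w(z))$ for all $z\in\mathbb{D}$. Theorem. Let $\alpha_1,\alpha_2,\alpha_3>0$ and let $m,k$ be real constants with $k\ge m\ge 2$. Set $$K=\alpha_1-\alpha_2-m^2\alpha_3-3m(k-1)\alpha_3,$$ and suppose that $K>0$ and $K(K-2e)\ge e^2$ (equivalently, $K\ge(1+\sqrt2)\,e$). Let $p$ be analytic in $\mathbb{D}$ with $p(0)=1$. If $$1+\alpha_1 zp'(z)+\alpha_2 z^2p''(z)+\alpha_3 z^3p'''(z)\prec\sqrt{1+z}$$ (principal branch of the square root), then $p(z)\prec e^z$. -/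

import Mathlib

/-- A Schwarz function: analytic on the open unit disc, `w 0 = 0` and `|w z| ≤ |z|` there. -/
structure IsSchwarzFunction (w : ℂ → ℂ) : Prop where
  analytic : AnalyticOnNhd ℂ w (Metric.ball 0 1)
  map_zero : w 0 = 0
  norm_le : ∀ z ∈ Metric.ball (0 : ℂ) 1, ‖w z‖ ≤ ‖z‖

/-- Subordination `h ≺ g` on the open unit disc: `h = g ∘ w` there for some Schwarz function `w`. -/
def Subordinate (h g : ℂ → ℂ) : Prop :=
  ∃ w : ℂ → ℂ, IsSchwarzFunction w ∧ ∀ z ∈ Metric.ball (0 : ℂ) 1, h z = g (w z)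

/-! The Euler operator acts diagonally on Taylor coefficients at 0, multiplying the `n`-th by at
least `α₁ n ≥ 6n`, since `α₁ ≥ K ≥ 6`. As `|√(1+w) - 1| ≤ |w|`, its image is bounded by 1, so a
Bessel inequality controls its coefficients in `ℓ²`. Dividing by `6n` and using Cauchy–Schwarz gives
`|p - 1| ≤ 1/2`. Then `log p` is analytic and bounded by 1, hence a Schwarz function. -/

open Complex Metric Finset in
/-- A weak Bessel inequality for the Taylor coefficients of a function bounded by one. -/
theorem sum_sq_taylorCoeff_mul_pow_le {F : ℂ → ℂ} (hF : DifferentiableOn ℂ F (ball 0 1))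
    (hb : ∀ z ∈ ball (0 : ℂ) 1, ‖F z‖ ≤ 1) {r : ℝ} (hr0 : 0 ≤ r) (hr : r < 1) (N : ℕ) :
    ∑ n ∈ range N, ‖(n.factorial : ℂ)⁻¹ * iteratedDeriv n F 0 * (r : ℂ) ^ n‖ ^ 2 ≤ 4 := by
  set b : ℕ → ℂ := fun n => (n.factorial : ℂ)⁻¹ * iteratedDeriv n F 0 * (r : ℂ) ^ n with hbdef
  have hsum : ∀ θ : ℂ, ‖θ‖ = 1 → HasSum (fun n => b n * θ ^ n) (F (r * θ)) := by
    intro θ hθ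
    have hm : (r : ℂ) * θ ∈ ball (0 : ℂ) 1 := by
      simp [hθ, abs_of_nonneg hr0, hr]
    refine (hasSum_taylorSeries_on_ball hF hm).congr_fun ?_
    intro n
    simp only [hbdef, sub_zero, smul_eq_mul, mul_pow]
    ring
  have hsb : Summable fun n => ‖b n‖ := by
    simpa using (hsum 1 (by simp)).summable.norm
  have hu : TendstoUniformlyOn (fun (M : ℕ) (θ : ℂ) => ∑ n ∈ range M, b n * θ ^ n)
      (fun θ => ∑' n, b n * θ ^ n) Filter.atTop (sphere (0 : ℂ) 1) := by
    refine tendstoUniformlyOn_tsum_nat hsb ?_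
    intro n θ hθ
    have : ‖θ‖ = 1 := by simpa using hθ
    simp [this]
  rw [Metric.tendstoUniformlyOn_iff] at hu
  -- Uniform error below 1 keeps the partial sum within norm 2 on the circle; its mean square is
  -- thus at most 4, and Parseval for polynomials applies.
  obtain ⟨M, hM, hNM⟩ := ((hu 1 one_pos).and (Filter.eventually_ge_atTop N)).exists
  have hS : ∀ θ ∈ sphere (0 : ℂ) 1, ‖∑ n ∈ range M, b n * θ ^ n‖ ≤ 2 := by
    intro θ hθ
    have h1 : ‖θ‖ = 1 := by simpa using hθ
    have h2 := hM θ hθ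
    rw [(hsum θ h1).tsum_eq, dist_comm, dist_eq_norm] at h2
    have h3 : ‖F (r * θ)‖ ≤ 1 := hb _ (by simp [h1, abs_of_nonneg hr0, hr])
    have h4 := norm_add_le (∑ n ∈ range M, b n * θ ^ n - F (r * θ)) (F (r * θ))
    rw [sub_add_cancel] at h4
    linarith
  let Q : Polynomial ℂ := ∑ n ∈ range M, Polynomial.monomial n (b n)
  have hQc : ∀ n, Q.coeff n = if n < M then b n else 0 := by
    intro n
    simp [Q, Polynomial.finsetSum_coeff, Polynomial.coeff_monomial]
  have hQe : ∀ θ, Q.eval θ = ∑ n ∈ range M, b n * θ ^ n := by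
    intro θ
    simp [Q, Polynomial.eval_finsetSum]
  have hle : Real.circleAverage (fun θ => ‖Q.eval θ‖ ^ 2) 0 1 ≤ 4 := by
    refine Real.circleAverage_mono_on_of_le_circle ?_ ?_
    · refine ContinuousOn.circleIntegrable zero_le_one (Continuous.continuousOn ?_)
      fun_prop
    · intro θ hθ
      rw [abs_one] at hθ
      have h := hS θ hθ
      rw [← hQe] at h
      nlinarith [norm_nonneg (Q.eval θ)]
  calc ∑ n ∈ range N, ‖b n‖ ^ 2 ≤ ∑ n ∈ range M, ‖b n‖ ^ 2 :=
        sum_le_sum_of_subset_of_nonneg (range_mono hNM) fun _ _ _ => by positivity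
    _ = ∑ n ∈ range M, ‖Q.coeff n‖ ^ 2 :=
        sum_congr rfl fun n hn => by rw [hQc, if_pos (mem_range.1 hn)]
    _ = ∑ n ∈ Q.support, ‖Q.coeff n‖ ^ 2 := by
        symm
        refine sum_subset ?_ ?_
        · intro n hn
          rw [Polynomial.mem_support_iff, hQc] at hn
          by_contra h
          exact hn (if_neg (by simpa using h))
        · intro n _ hn
          simp [Polynomial.notMem_support_iff.1 hn]
    _ ≤ 4 := by rw [Polynomial.sum_sq_norm_coeff_eq_circleAverage]; exact hle

-- In the Leibniz formula at 0, only the term differentiating `z ^ j` exactly `j` times survives.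
open Finset in
theorem iteratedDeriv_pow_mul_iteratedDeriv_zero {p : ℂ → ℂ} (hp : AnalyticAt ℂ p 0) (n j : ℕ) :
    iteratedDeriv n (fun z => z ^ j * iteratedDeriv j p z) 0 =
      (n.descFactorial j : ℂ) * iteratedDeriv n p 0 := by
  have hq : ContDiffAt ℂ n (iteratedDeriv j p) 0 := by
    rw [iteratedDeriv_eq_iterate]
    exact (hp.iterated_deriv j).contDiffAt
  rw [iteratedDeriv_fun_mul (by fun_prop) hq]
  simp only [iteratedDeriv_fun_pow_zero]
  rcases lt_or_ge n j with h | h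
  · rw [Nat.descFactorial_of_lt h]
    simp only [Nat.cast_zero, zero_mul]
    refine sum_eq_zero fun i hi => ?_
    rw [if_neg (by have := mem_range.1 hi; omega)]
    simp
  · rw [sum_eq_single_of_mem j (mem_range.2 (by omega))]
    · rw [if_pos rfl, Nat.descFactorial_eq_factorial_mul_choose]
      have : iteratedDeriv (n - j) (iteratedDeriv j p) 0 = iteratedDeriv n p 0 := by
        simp only [iteratedDeriv_eq_iterate]
        rw [← Function.iterate_add_apply, Nat.sub_add_cancel h]
      rw [this]
      push_cast
      ring
    · intro i _ hij
      simp [hij]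

/-- The third-order Euler operator `α₁ z p' + α₂ z² p'' + α₃ z³ p'''`. -/
noncomputable def eulerOperator (α₁ α₂ α₃ : ℝ) (p : ℂ → ℂ) (z : ℂ) : ℂ :=
  (α₁ : ℂ) * (z ^ 1 * iteratedDeriv 1 p z) + (α₂ : ℂ) * (z ^ 2 * iteratedDeriv 2 p z)
    + (α₃ : ℂ) * (z ^ 3 * iteratedDeriv 3 p z)

theorem analyticAt_pow_mul_iteratedDeriv {p : ℂ → ℂ} {z : ℂ} (hp : AnalyticAt ℂ p z) (j : ℕ) :
    AnalyticAt ℂ (fun z => z ^ j * iteratedDeriv j p z) z := by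
  have : AnalyticAt ℂ (iteratedDeriv j p) z := by
    rw [iteratedDeriv_eq_iterate]
    exact hp.iterated_deriv j
  fun_prop

theorem analyticAt_eulerOperator (α₁ α₂ α₃ : ℝ) {p : ℂ → ℂ} {z : ℂ} (hp : AnalyticAt ℂ p z) :
    AnalyticAt ℂ (eulerOperator α₁ α₂ α₃ p) z :=
  ((analyticAt_const.mul (analyticAt_pow_mul_iteratedDeriv hp 1)).add
    (analyticAt_const.mul (analyticAt_pow_mul_iteratedDeriv hp 2))).add
    (analyticAt_const.mul (analyticAt_pow_mul_iteratedDeriv hp 3))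

theorem iteratedDeriv_eulerOperator_zero (α₁ α₂ α₃ : ℝ) {p : ℂ → ℂ} (hp : AnalyticAt ℂ p 0)
    (n : ℕ) :
    iteratedDeriv n (eulerOperator α₁ α₂ α₃ p) 0 =
      ((α₁ * n.descFactorial 1 + α₂ * n.descFactorial 2 + α₃ * n.descFactorial 3 : ℝ) : ℂ) *
        iteratedDeriv n p 0 := by
  have h (j : ℕ) : ContDiffAt ℂ n (fun z => z ^ j * iteratedDeriv j p z) 0 :=
    (analyticAt_pow_mul_iteratedDeriv hp j).contDiffAt
  unfold eulerOperator
  rw [iteratedDeriv_fun_add ((contDiffAt_const.mul (h 1)).add (contDiffAt_const.mul (h 2)))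
      (contDiffAt_const.mul (h 3)),
    iteratedDeriv_fun_add (contDiffAt_const.mul (h 1)) (contDiffAt_const.mul (h 2)),
    iteratedDeriv_const_mul _ (h 1), iteratedDeriv_const_mul _ (h 2),
    iteratedDeriv_const_mul _ (h 3)]
  simp only [iteratedDeriv_pow_mul_iteratedDeriv_zero hp]
  push_cast
  ring

-- With `s = √(1+w)`, `w = (s - 1)(s + 1)`, and `Re s ≥ 0` forces `|s + 1| ≥ 1`.
open Complex in
theorem norm_one_add_cpow_half_sub_one_le (w : ℂ) : ‖(1 + w) ^ (1 / 2 : ℂ) - 1‖ ≤ ‖w‖ := by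
  set s := (1 + w) ^ (1 / 2 : ℂ) with hs
  have hsq : s ^ 2 = 1 + w := by
    have := cpow_nat_inv_pow (1 + w) two_ne_zero
    rw [hs, one_div]
    exact_mod_cast this
  have hre : 0 ≤ s.re := by
    have h : s = (1 + w) ^ ((1 / 2 : ℝ) : ℂ) := by rw [hs]; norm_num
    by_cases h0 : 1 + w = 0
    · rw [hs, h0]; simp
    rw [h, cpow_ofReal_re]
    refine mul_nonneg (by positivity) (Real.cos_nonneg_of_mem_Icc ⟨?_, ?_⟩)
    · have := neg_pi_lt_arg (1 + w); linarith
    · have := arg_le_pi (1 + w); linarith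
  have h1 : 1 ≤ ‖s + 1‖ := by
    have := re_le_norm (s + 1)
    simp at this
    linarith
  have h2 : w = (s - 1) * (s + 1) := by linear_combination -hsq
  calc ‖s - 1‖ = ‖s - 1‖ * 1 := (mul_one _).symm
    _ ≤ ‖s - 1‖ * ‖s + 1‖ := by gcongr
    _ = ‖w‖ := by rw [← norm_mul, ← h2]

open Complex Metric Finset in
theorem norm_sub_one_le_half_of_norm_eulerOperator_le_one {α₁ α₂ α₃ : ℝ} (hα₁ : 6 ≤ α₁)
    (hα₂ : 0 ≤ α₂) (hα₃ : 0 ≤ α₃) {p : ℂ → ℂ} (hp : AnalyticOnNhd ℂ p (ball 0 1)) (hp0 : p 0 = 1)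
    (hb : ∀ z ∈ ball (0 : ℂ) 1, ‖eulerOperator α₁ α₂ α₃ p z‖ ≤ 1) {z : ℂ}
    (hz : z ∈ ball (0 : ℂ) 1) : ‖p z - 1‖ ≤ 1 / 2 := by
  have hp' : AnalyticAt ℂ p 0 := hp 0 (by simp)
  have hz1 : ‖z‖ < 1 := by simpa using hz
  set b : ℕ → ℂ := fun n =>
    (n.factorial : ℂ)⁻¹ * iteratedDeriv n (eulerOperator α₁ α₂ α₃ p) 0 * (‖z‖ : ℂ) ^ n with hbdef
  have hbessel : ∀ N, ∑ n ∈ range N, ‖b n‖ ^ 2 ≤ 4 :=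
    sum_sq_taylorCoeff_mul_pow_le
      (fun x hx => (analyticAt_eulerOperator α₁ α₂ α₃ (hp x hx)).differentiableWithinAt)
      hb (norm_nonneg z) hz1
  set a : ℕ → ℂ := fun n => (n.factorial : ℂ)⁻¹ • (z - 0) ^ n • iteratedDeriv n p 0 with hadef
  have ha : HasSum a (p z) := hasSum_taylorSeries_on_ball hp.differentiableOn hz
  have hab : ∀ n, 6 * n * ‖a n‖ ≤ ‖b n‖ := by
    intro n
    have h1 : ‖b n‖ = (α₁ * n.descFactorial 1 + α₂ * n.descFactorial 2
        + α₃ * n.descFactorial 3) * ‖a n‖ := by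
      simp only [hbdef, hadef, iteratedDeriv_eulerOperator_zero _ _ _ hp', norm_mul, norm_smul,
        sub_zero, norm_pow, Complex.norm_real, Real.norm_eq_abs, abs_norm]
      rw [abs_of_nonneg (by positivity)]
      ring
    rw [h1]
    gcongr
    have h2 : 0 ≤ α₂ * n.descFactorial 2 + α₃ * n.descFactorial 3 := by positivity
    have h3 : 6 * (n : ℝ) ≤ α₁ * n := by gcongr
    rw [Nat.descFactorial_one]
    linarith
  have hfin : ∀ N, ‖∑ n ∈ range (N + 1), a n - 1‖ ≤ 1 / 2 := by
    intro N
    have h0 : a 0 = 1 := by simp [hadef, hp0]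
    rw [sum_range_succ', h0, add_sub_cancel_right]
    have h1 : ‖∑ n ∈ range N, a (n + 1)‖ ≤ ∑ n ∈ range N, ‖b (n + 1)‖ * (6 * ((n : ℝ) + 1))⁻¹ := by
      refine (norm_sum_le _ _).trans (sum_le_sum fun n _ => ?_)
      rw [← div_eq_mul_inv, le_div_iff₀ (by positivity), mul_comm]
      have := hab (n + 1)
      push_cast at this
      exact this
    have h2 := sum_mul_sq_le_sq_mul_sq (range N) (fun n => ‖b (n + 1)‖)
      (fun n => (6 * ((n : ℝ) + 1))⁻¹)
    have h3 : ∑ n ∈ range N, ‖b (n + 1)‖ ^ 2 ≤ 4 := by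
      have := hbessel (N + 1)
      rw [sum_range_succ'] at this
      have h := sq_nonneg ‖b 0‖
      linarith
    -- Uses the crude bound `∑ 1/i² ≤ 2`.
    have h4 : ∑ n ∈ range N, ((6 * ((n : ℝ) + 1))⁻¹) ^ 2 ≤ 2 / 36 := by
      have h := sum_Ioo_inv_sq_le (α := ℝ) 0 (N + 1)
      have h5 : ∑ n ∈ range N, ((6 * ((n : ℝ) + 1))⁻¹) ^ 2
          = (1 / 36) * ∑ i ∈ Ioo 0 (N + 1), ((i : ℝ) ^ 2)⁻¹ := by
        have : Ioo 0 (N + 1) = Ico (0 + 1) (N + 1) := by ext; simp; omega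
        rw [this, ← sum_Ico_add', Nat.Ico_zero_eq_range, mul_sum]
        refine sum_congr rfl fun n _ => ?_
        push_cast
        field_simp
        norm_num
      rw [h5]
      norm_num at h
      linarith
    have h6 : (∑ n ∈ range N, ‖b (n + 1)‖ ^ 2) * ∑ n ∈ range N, ((6 * ((n : ℝ) + 1))⁻¹) ^ 2
        ≤ 4 * (2 / 36) := by
      refine mul_le_mul h3 h4 (sum_nonneg fun _ _ => by positivity) (by norm_num)
    -- `4 · 2/36 = 2/9 ≤ (1/2)²`.
    refine h1.trans (abs_le_of_sq_le_sq' ?_ (by norm_num)).2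
    refine (h2.trans h6).trans (by norm_num)
  refine le_of_tendsto
    (((ha.tendsto_sum_nat.comp (Filter.tendsto_add_atTop_nat 1)).sub_const 1).norm)
    (Filter.Eventually.of_forall hfin)

open Complex Metric in
theorem subordinate_exp_of_norm_sub_one_le_half {p : ℂ → ℂ} (hp : AnalyticOnNhd ℂ p (ball 0 1))
    (hp0 : p 0 = 1) (hb : ∀ z ∈ ball (0 : ℂ) 1, ‖p z - 1‖ ≤ 1 / 2) :
    Subordinate p Complex.exp := by
  have hslit : ∀ z ∈ ball (0 : ℂ) 1, p z ∈ slitPlane := by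
    intro z hz
    have := mem_slitPlane_of_norm_lt_one (z := p z - 1) ((hb z hz).trans_lt (by norm_num))
    rwa [add_sub_cancel] at this
  have han : AnalyticOnNhd ℂ (fun z => log (p z)) (ball 0 1) := fun z hz =>
    (hp z hz).clog (hslit z hz)
  refine ⟨fun z => log (p z), ⟨han, by simp [hp0], fun z hz => ?_⟩, fun z hz =>
    (exp_log (slitPlane_ne_zero (hslit z hz))).symm⟩
  refine norm_le_norm_of_mapsTo_ball (R := 1) han.differentiableOn ?_ (by simp [hp0])
    (by simpa using hz)
  intro x hx
  -- Gives `|log p| ≤ (3/2)(1/2) = 3/4`, enough for the Schwarz lemma.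
  have h := norm_log_one_add_half_le_self (hb x hx)
  rw [add_sub_cancel] at h
  have := hb x hx
  rw [mem_closedBall_zero_iff]
  linarith

theorem mainTheorem10 (α₁ α₂ α₃ m k K : ℝ)
    (hα₁ : 0 < α₁) (hα₂ : 0 < α₂) (hα₃ : 0 < α₃) (hm : 2 ≤ m) (hmk : m ≤ k)
    (hK : K = α₁ - α₂ - m ^ 2 * α₃ - 3 * m * (k - 1) * α₃)
    (hKpos : 0 < K)
    (hKe : K * (K - 2 * Real.exp 1) ≥ Real.exp 1 ^ 2)
    (p : ℂ → ℂ) (hp : AnalyticOnNhd ℂ p (Metric.ball 0 1)) (hp0 : p 0 = 1)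
    (hsub : Subordinate
      (fun z => 1 + (α₁ : ℂ) * (z * deriv p z) + (α₂ : ℂ) * (z ^ 2 * iteratedDeriv 2 p z)
        + (α₃ : ℂ) * (z ^ 3 * iteratedDeriv 3 p z))
      (fun z => (1 + z) ^ (1 / 2 : ℂ))) :
    Subordinate p Complex.exp := by
  -- If `K < 6`, then `K - 2e < 0.6`, so `K(K - 2e) < 3.6 < e²`.
  have he := Real.exp_one_gt_d9
  have hK6 : 6 ≤ K := by
    by_contra! h
    have h2 : 0 < K - 2 * Real.exp 1 := by
      by_contra! h2
      have := mul_nonpos_of_nonneg_of_nonpos hKpos.le h2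
      nlinarith
    nlinarith
  have hα6 : 6 ≤ α₁ := by
    have h1 : 0 ≤ m ^ 2 * α₃ := by positivity
    have h2 : 0 ≤ 3 * m * (k - 1) * α₃ :=
      mul_nonneg (mul_nonneg (by linarith) (by linarith)) hα₃.le
    linarith
  obtain ⟨w, hw, hpw⟩ := hsub
  refine subordinate_exp_of_norm_sub_one_le_half hp hp0 fun z hz =>
    norm_sub_one_le_half_of_norm_eulerOperator_le_one hα6 hα₂.le hα₃.le hp hp0 ?_ hz
  intro x hx
  have h1 : eulerOperator α₁ α₂ α₃ p x = (1 + w x) ^ (1 / 2 : ℂ) - 1 := by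
    have h := hpw x hx
    simp only at h
    rw [← h, eulerOperator, iteratedDeriv_one, pow_one]
    ring
  have hx1 : ‖x‖ < 1 := by simpa using hx
  rw [h1]
  exact ((norm_one_add_cpow_half_sub_one_le _).trans (hw.norm_le x hx)).trans hx1.le
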